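/- **Model.** There are $n\ge 1$ nodes in a fully connected network. A set $\mathcal H$ of nodes is honest, the others are faulty. Each $v\in\mathcal H$ has a hardware clock $H_v:\mathbb R_{\ge 0}\to\mathbb R_{\ge 0}$ with $t'-t\le H_v(t')-H_v(t)\le\vartheta(t'-t)$ for all $t'\ge t\ge 0$, and $H_v(0)\in[0,S]$. A message sent at time $t\geq 0$ to or from an honest node is received at a time in $[t+d-u,\,t+d]$ (delays and clocks are chosen by an adversary; also messages of a node to itself are of this kind, and a message between two faulty nodes is not received before it is sent); only finitely many messages are sent in finite time. Honest nodes follow the algorithm. Faulty nodes may send any messages at any times, except that a message sent by a faulty node at time $t$ may contain a signature of an honest node only if some faulty node has received this signature, in a message from an honest node, by time $t$. Write $\langle r\rangle_w$ for the signature of node $w$ on $r\in\mathbb N$. **Pulse synchronization.** A protocol is an *$f$-secure pulse synchronization protocol with skew $\mathcal S$, minimum period $P_{\min}>0$ and maximum period $P_{\max}$* if in every execution with at most $f$ faulty nodes each $v\in\mathcal H$ outputs its $i$-th pulse exactly once, at some time $p_{v,i}$, for each integer $i\ge 1$, and for all $i\ge 1$ and $v,w\in\mathcal H$ we have $|p_{v,i}-p_{w,i}|\le\mathcal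 S$ and $P_{\min}\le p_{v,i+1}-p_{w,i}\le P_{\max}$. **Algorithm CPS** (with parameters $S,T$ and $f=\lceil n/2\rceil-1$), at node $v$. Output the first pulse at local time $S$. For $r=1,2,\dots$, let $P$ be the local time of the $r$-th pulse of $v$. Then: 1. Send $\langle r\rangle_v$ to all nodes (including $v$) at local time $P+\vartheta S$; $h_{v,v}$ is the first local time in $(P,\,P+\vartheta(d+(\vartheta+1)S)]$ at which $v$ receives this message from itself. 2. For each node $w\ne v$: if $\langle r\rangle_w$ is not received from $w$ at a local time in $(P,\,P+\vartheta(d+(\vartheta+1)S)]$, then $h_{v,w}=\bot$. Otherwise let $h$ be the first such local time and forward $\langle r\rangle_w$ to all nodes at local time $h$. If $v$ receives $\langle r\rangle_w$ from some node $x\ne w$ at a local time in $(P,\,h+d-2u)$, then $h_{v,w}=\bot$; otherwise $h_{v,w}=h$, and this is output at local time $h+d-2u$. 3. For each $w$ with $h_{v,w}\ne\bot$ let $\Delta_{v,w}=h_{v,w}-P-d+u-S$. Let $b$ be the number of $w$ with $h_{v,w}=\bot$. Sort the values $\Delta_{v,w}$, discard the lowest $f-b$ and the highest $f-b$ of them (none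 if $b\geq f$), and let $\Delta$ be the midpoint of the interval spanned by the remaining ones. 4. Output the $(r+1)$-th pulse at local time $P+\Delta+T$. (If step 2 has not yet ended for all $w$ at this local time, or no value remains in step 3, then $v$ outputs no further pulse.) **Statement.** There are absolute constants $c,C>0$ such that for all real $\vartheta,d,u$ with $1<\vartheta\le 1.11$, $d>0$ and $0\le u\le d/30$ there are $T,S,P_{\min},P_{\max}$ with $$cd\le T\le Cd,\qquad c\,(u+(\vartheta-1)d)\le S\le C\,(u+(\vartheta-1)d),$$ $$cd\le P_{\min}\le Cd,\qquad P_{\min}+cS\le P_{\max}\le P_{\min}+CS,$$ such that for every $n\ge 1$ Algorithm CPS with parameters $S,T$ is a $(\lceil n/2\rceil-1)$-secure pulse synchronization protocol with skew $S$, minimum period $P_{\min}$ and maximum period $P_{\max}$. -/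

import Mathlib

/-!
Nodes are the elements of `Fin n`.  Signatures are symbolic: the signature of node `w` on the
round number `r` is the pair `(w, r)`.  Unforgeability is the condition `unforgeable` in
`Execution.Admissible`.
-/

/-- The signature of node `signer` on the number `round`. -/
structure Signature (n : ℕ) where
  signer : Fin n
  round : ℕ

/-- The relevant content of a message: the finite set of signatures that it contains. -/
abbrev Payload (n : ℕ) := Finset (Signature n)

/-- The event that a node receives a message with content `payload` from `sender` when its
hardware clock shows `localTime`. -/
structure Reception (n : ℕ) where
  sender : Fin n
  payload : Payload n
  localTime : ℝ

/-- The event that a node sends a message with content `payload` to `receiver` when its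
hardware clock shows `localTime`. -/
structure Sending (n : ℕ) where
  receiver : Fin n
  payload : Payload n
  localTime : ℝ

/-- The reception logs `R` and `R'` coincide up to and including local time `t`. -/
def AgreeUpTo {n : ℕ} (t : ℝ) (R R' : Set (Reception n)) : Prop :=
  ∀ e : Reception n, e.localTime ≤ t → (e ∈ R ↔ e ∈ R')

/-- A deterministic protocol for `n` nodes.  From the receptions of a node `v` (with their local
times) it determines what `v` sends at which local time, and which pulses `v` outputs:
`(i, h) ∈ pulses v R` means that `v` outputs its `i`-th pulse at local time `h`.
Actions taken by local time `t` depend only on the receptions up to local time `t`. -/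
structure Protocol (n : ℕ) where
  sends : Fin n → Set (Reception n) → Set (Sending n)
  pulses : Fin n → Set (Reception n) → Set (ℕ × ℝ)
  causal_sends : ∀ (v : Fin n) (R R' : Set (Reception n)) (t : ℝ), AgreeUpTo t R R' →
    ∀ e ∈ sends v R, e.localTime ≤ t → e ∈ sends v R'
  causal_pulses : ∀ (v : Fin n) (R R' : Set (Reception n)) (t : ℝ), AgreeUpTo t R R' →
    ∀ q ∈ pulses v R, q.2 ≤ t → q ∈ pulses v R'

/-- A message together with the (real) times at which it is sent and received. -/
structure Message (n : ℕ) where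
  sender : Fin n
  receiver : Fin n
  payload : Payload n
  sentAt : ℝ
  recvAt : ℝ

/-- The data of an execution: the set of honest nodes, the hardware clocks (only those of honest
nodes matter, at times `t ≥ 0`), and all messages with their sending and reception times. -/
structure Execution (n : ℕ) where
  honest : Finset (Fin n)
  clock : Fin n → ℝ → ℝ
  msgs : Set (Message n)

namespace Execution

/-- What node `v` receives, at which local times. -/
def log {n : ℕ} (E : Execution n) (v : Fin n) : Set (Reception n) :=
  {e | ∃ m ∈ E.msgs, m.receiver = v ∧ e = ⟨m.sender, m.payload, E.clock v m.recvAt⟩}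

/-- `E` is a well-defined execution of the protocol `A` in the network model with maximum delay
`d`, delay uncertainty `u`, maximum clock rate `ϑ` and initial local times in `[0, σ]`. -/
structure Admissible {n : ℕ} (E : Execution n) (A : Protocol n) (ϑ d u σ : ℝ) : Prop where
  clock_init : ∀ v ∈ E.honest, 0 ≤ E.clock v 0 ∧ E.clock v 0 ≤ σ
  clock_rate : ∀ v ∈ E.honest, ∀ t t' : ℝ, 0 ≤ t → t ≤ t' →
    t' - t ≤ E.clock v t' - E.clock v t ∧ E.clock v t' - E.clock v t ≤ ϑ * (t' - t)
  sent_nonneg : ∀ m ∈ E.msgs, 0 ≤ m.sentAt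
  sent_le_recv : ∀ m ∈ E.msgs, m.sentAt ≤ m.recvAt
  /-- Delays of messages to or from honest nodes (faulty nodes obey the minimum delay, too). -/
  delay : ∀ m ∈ E.msgs, (m.sender ∈ E.honest ∨ m.receiver ∈ E.honest) →
    d - u ≤ m.recvAt - m.sentAt ∧ m.recvAt - m.sentAt ≤ d
  /-- Only finitely many messages are sent in finite time. -/
  finite_sent : ∀ t : ℝ, {m ∈ E.msgs | m.sentAt ≤ t}.Finite
  /-- Honest nodes send exactly the messages that the protocol prescribes. -/
  honest_sends : ∀ v ∈ E.honest, ∀ (w : Fin n) (M : Payload n) (t : ℝ), 0 ≤ t →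
    ((∃ m ∈ E.msgs, m.sender = v ∧ m.receiver = w ∧ m.payload = M ∧ m.sentAt = t) ↔
      (⟨w, M, E.clock v t⟩ : Sending n) ∈ A.sends v (E.log v))
  /-- A message sent by an honest node is delivered only once. -/
  honest_once : ∀ m ∈ E.msgs, ∀ m' ∈ E.msgs, m.sender ∈ E.honest → m.sender = m'.sender →
    m.receiver = m'.receiver → m.payload = m'.payload → m.sentAt = m'.sentAt → m = m'
  /-- Faulty nodes send whatever and whenever they like, except that a message sent by a faulty
  node can contain the signature of an honest node only if by then some faulty node has received
  that signature (from an honest node; faulty nodes may share all that they know). -/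
  unforgeable : ∀ m ∈ E.msgs, m.sender ∉ E.honest → ∀ s ∈ m.payload, s.signer ∈ E.honest →
    ∃ m' ∈ E.msgs, m'.sender ∈ E.honest ∧ m'.receiver ∉ E.honest ∧ s ∈ m'.payload ∧
      m'.recvAt ≤ m.sentAt

/-- In the execution `E` of `A`, node `v` outputs its `i`-th pulse at time `t`. -/
def PulseAt {n : ℕ} (E : Execution n) (A : Protocol n) (v : Fin n) (i : ℕ) (t : ℝ) : Prop :=
  0 ≤ t ∧ (i, E.clock v t) ∈ A.pulses v (E.log v)

end Execution

/-- `A` is an `f`-secure protocol for pulse synchronization with skew `𝒮`, minimum period `Pmin`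
and maximum period `Pmax`, in the network model with parameters `ϑ`, `d`, `u` and initial local
times in `[0, σ]`.  Pulses are numbered from `1`. -/
structure Protocol.IsPulseSync {n : ℕ} (A : Protocol n) (ϑ d u σ : ℝ) (f : ℕ)
    (𝒮 Pmin Pmax : ℝ) : Prop where
  pmin_pos : 0 < Pmin
  liveness : ∀ E : Execution n, E.Admissible A ϑ d u σ → (E.honestᶜ).card ≤ f →
    ∀ v ∈ E.honest, ∀ i : ℕ, 1 ≤ i → ∃! t : ℝ, E.PulseAt A v i t
  skew : ∀ E : Execution n, E.Admissible A ϑ d u σ → (E.honestᶜ).card ≤ f →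
    ∀ v ∈ E.honest, ∀ w ∈ E.honest, ∀ i : ℕ, 1 ≤ i → ∀ t t' : ℝ,
      E.PulseAt A v i t → E.PulseAt A w i t' → |t - t'| ≤ 𝒮
  min_period : ∀ E : Execution n, E.Admissible A ϑ d u σ → (E.honestᶜ).card ≤ f →
    ∀ v ∈ E.honest, ∀ w ∈ E.honest, ∀ i : ℕ, 1 ≤ i → ∀ t t' : ℝ,
      E.PulseAt A v (i + 1) t → E.PulseAt A w i t' → Pmin ≤ t - t'
  max_period : ∀ E : Execution n, E.Admissible A ϑ d u σ → (E.honestᶜ).card ≤ f →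
    ∀ v ∈ E.honest, ∀ w ∈ E.honest, ∀ i : ℕ, 1 ≤ i → ∀ t t' : ℝ,
      E.PulseAt A v (i + 1) t → E.PulseAt A w i t' → t - t' ≤ Pmax

namespace CPS

/-- The numbers that Algorithm CPS uses. -/
structure Params where
  ϑ : ℝ
  d : ℝ
  u : ℝ
  S : ℝ
  T : ℝ

/-- The local times in `(P, P + ϑ (d + (ϑ + 1) S)]` at which the signature of the dealer `w` on
`r` is received from `w` itself. -/
def dealerTimes {n : ℕ} (c : Params) (R : Set (Reception n)) (r : ℕ) (P : ℝ) (w : Fin n) :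
    Set ℝ :=
  {h | P < h ∧ h ≤ P + c.ϑ * (c.d + (c.ϑ + 1) * c.S) ∧
    ∃ e ∈ R, e.sender = w ∧ (⟨w, r⟩ : Signature n) ∈ e.payload ∧ e.localTime = h}

/-- The local times in `(P, B)` at which the signature of the dealer `w` on `r` is received from
a node other than `w`. -/
def echoTimes {n : ℕ} (R : Set (Reception n)) (r : ℕ) (P : ℝ) (w : Fin n) (B : ℝ) : Set ℝ :=
  {h | P < h ∧ h < B ∧
    ∃ e ∈ R, e.sender ≠ w ∧ (⟨w, r⟩ : Signature n) ∈ e.payload ∧ e.localTime = h}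

/-- Timed Crusader Broadcast.  `TCB c v R r P w o τ`: node `v`, which generated its `r`-th pulse
at local time `P` and receives `R`, terminates the instance for round `r` with dealer `w` at local
time `τ` and with output `o`, where `none` stands for `⊥`.  In its own instance the dealer also
receives its own broadcast, and uses the local reception time. -/
inductive TCB {n : ℕ} (c : Params) (v : Fin n) (R : Set (Reception n)) (r : ℕ) (P : ℝ)
    (w : Fin n) : Option ℝ → ℝ → Prop
  | own (h : ℝ) (hw : w = v) (hh : IsLeast (dealerTimes c R r P w) h) :
      TCB c v R r P w (some h) h
  | missing (hw : w ≠ v) (hh : dealerTimes c R r P w = ∅) :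
      TCB c v R r P w none (P + c.ϑ * (c.d + (c.ϑ + 1) * c.S))
  | rejected (h h' : ℝ) (hw : w ≠ v) (hh : IsLeast (dealerTimes c R r P w) h)
      (he : IsLeast (echoTimes R r P w (h + c.d - 2 * c.u)) h') :
      TCB c v R r P w none (max h h')
  | accepted (h : ℝ) (hw : w ≠ v) (hh : IsLeast (dealerTimes c R r P w) h)
      (he : echoTimes R r P w (h + c.d - 2 * c.u) = ∅) :
      TCB c v R r P w (some h) (max h (h + c.d - 2 * c.u))

/-- The list of all values different from `none`, with multiplicity, in ascending order. -/
noncomputable def sortedValues {n : ℕ} (x : Fin n → Option ℝ) : List ℝ :=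
  ((Finset.univ : Finset (Fin n)).val.filterMap x).sort (· ≤ ·)

/-- The number of values equal to `none`. -/
def numBot {n : ℕ} (x : Fin n → Option ℝ) : ℕ :=
  (Finset.univ.filter (fun w => (x w).isNone = true)).card

/-- With `b` the number of values `none`: after the lowest `f - b` and the highest `f - b` of the
other values have been discarded, at least one is left, the remaining ones span `[lo, hi]`, and
`m` is the midpoint of this interval. -/
def IsTrimmedMidpoint {n : ℕ} (f : ℕ) (x : Fin n → Option ℝ) (m : ℝ) : Prop :=
  2 * (f - numBot x) < (sortedValues x).length ∧
  ∃ lo hi : ℝ, (sortedValues x)[f - numBot x]? = some lo ∧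
    (sortedValues x)[(sortedValues x).length - 1 - (f - numBot x)]? = some hi ∧
    m = (lo + hi) / 2

/-- `IsPulse c v R r P`: in Algorithm CPS, node `v` with receptions `R` generates its `r`-th pulse
at local time `P`.  The next pulse is generated at local time `P + Δ + T`, provided that all
instances of the broadcast have terminated by then (otherwise that local time has passed when `Δ`
is known, and `v` generates no further pulse). -/
inductive IsPulse {n : ℕ} (c : Params) (v : Fin n) (R : Set (Reception n)) : ℕ → ℝ → Prop
  | first : IsPulse c v R 1 c.S
  | next (r : ℕ) (P Δ : ℝ) (h : Fin n → Option ℝ) (τ : Fin n → ℝ)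
      (hP : IsPulse c v R r P)
      (htcb : ∀ w, TCB c v R r P w (h w) (τ w))
      (hΔ : IsTrimmedMidpoint (⌈(n : ℝ) / 2⌉₊ - 1)
        (fun w => (h w).map fun x => x - P - c.d + c.u - c.S) Δ)
      (hτ : ∀ w, τ w ≤ P + Δ + c.T) :
      IsPulse c v R (r + 1) (P + Δ + c.T)

/-- What node `v` sends, to all nodes: its own signature on `r` at local time `P + ϑ S`, where `P`
is the local time of its `r`-th pulse, and, as a non-dealer, the signature on `r` of `w` at the
first local time at which it is received from `w` in time. -/
def sends {n : ℕ} (c : Params) (v : Fin n) (R : Set (Reception n)) : Set (Sending n) :=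
  {e | ∃ (r : ℕ) (P : ℝ), IsPulse c v R r P ∧
    ((e.payload = {(⟨v, r⟩ : Signature n)} ∧ e.localTime = P + c.ϑ * c.S ∧ P ≤ e.localTime) ∨
      ∃ w, w ≠ v ∧ e.payload = {(⟨w, r⟩ : Signature n)} ∧
        IsLeast (dealerTimes c R r P w) e.localTime)}

theorem isLeast_dealerTimes_congr {n : ℕ} {c : Params} {R R' : Set (Reception n)} {r : ℕ}
    {P : ℝ} {w : Fin n} {h t : ℝ} (hR : AgreeUpTo t R R') (ht : h ≤ t)
    (hh : IsLeast (dealerTimes c R r P w) h) : IsLeast (dealerTimes c R' r P w) h := by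
  obtain ⟨⟨h1, h2, e, he, hs, hp, hl⟩, hmin⟩ := hh
  refine ⟨⟨h1, h2, e, (hR e (by linarith)).1 he, hs, hp, hl⟩, ?_⟩
  rintro x ⟨x1, x2, e', he', hs', hp', hl'⟩
  by_contra hx
  push Not at hx
  exact absurd (hmin ⟨x1, x2, e', (hR e' (by linarith)).2 he', hs', hp', hl'⟩) (not_le.2 hx)

theorem isLeast_echoTimes_congr {n : ℕ} {R R' : Set (Reception n)} {r : ℕ}
    {P B : ℝ} {w : Fin n} {h t : ℝ} (hR : AgreeUpTo t R R') (ht : h ≤ t)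
    (hh : IsLeast (echoTimes R r P w B) h) : IsLeast (echoTimes R' r P w B) h := by
  obtain ⟨⟨h1, h2, e, he, hs, hp, hl⟩, hmin⟩ := hh
  refine ⟨⟨h1, h2, e, (hR e (by linarith)).1 he, hs, hp, hl⟩, ?_⟩
  rintro x ⟨x1, x2, e', he', hs', hp', hl'⟩
  by_contra hx
  push Not at hx
  exact absurd (hmin ⟨x1, x2, e', (hR e' (by linarith)).2 he', hs', hp', hl'⟩) (not_le.2 hx)

theorem TCB.congr {n : ℕ} {c : Params} {v : Fin n} {R R' : Set (Reception n)} {r : ℕ}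
    {P : ℝ} {w : Fin n} {o : Option ℝ} {τ t : ℝ} (hR : AgreeUpTo t R R') (ht : τ ≤ t)
    (h : TCB c v R r P w o τ) : TCB c v R' r P w o τ := by
  cases h with
  | own h hw hh => exact .own _ hw (isLeast_dealerTimes_congr hR ht hh)
  | missing hw hh =>
    refine .missing hw (Set.eq_empty_of_forall_notMem ?_)
    rintro x ⟨x1, x2, e, he, hs, hp, hl⟩
    exact Set.eq_empty_iff_forall_notMem.1 hh x
      ⟨x1, x2, e, (hR e (by linarith)).2 he, hs, hp, hl⟩
  | rejected h h' hw hh he =>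
    exact .rejected _ _ hw (isLeast_dealerTimes_congr hR ((le_max_left _ _).trans ht) hh)
      (isLeast_echoTimes_congr hR ((le_max_right _ _).trans ht) he)
  | accepted h hw hh he =>
    refine .accepted _ hw (isLeast_dealerTimes_congr hR ((le_max_left _ _).trans ht) hh)
      (Set.eq_empty_of_forall_notMem ?_)
    rintro x ⟨x1, x2, e, he', hs, hp, hl⟩
    have h3 := (le_max_right _ _).trans ht
    exact Set.eq_empty_iff_forall_notMem.1 he x
      ⟨x1, x2, e, (hR e (by linarith)).2 he', hs, hp, hl⟩

theorem TCB.lt {n : ℕ} {c : Params} {v : Fin n} {R : Set (Reception n)} {r : ℕ}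
    {P : ℝ} {o : Option ℝ} {τ : ℝ} (h : TCB c v R r P v o τ) : P < τ := by
  cases h with
  | own h hw hh => exact hh.1.1
  | missing hw hh => exact absurd rfl hw
  | rejected h h' hw hh he => exact absurd rfl hw
  | accepted h hw hh he => exact absurd rfl hw

theorem IsPulse.congr {n : ℕ} {c : Params} {v : Fin n} {R R' : Set (Reception n)} {r : ℕ}
    {P t : ℝ} (hR : AgreeUpTo t R R') (h : IsPulse c v R r P) (ht : P ≤ t) :
    IsPulse c v R' r P := by
  induction h with
  | first => exact .first
  | next r P Δ h τ hP htcb hΔ hτ ih =>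
    exact .next r P Δ h τ (ih (((htcb v).lt.le.trans (hτ v)).trans ht))
      (fun w => (htcb w).congr hR ((hτ w).trans ht)) hΔ hτ

end CPS

/-- Algorithm CPS for `n` nodes, with the parameters `S` and `T`. -/
def CPS (n : ℕ) (ϑ d u S T : ℝ) : Protocol n where
  sends v R := CPS.sends ⟨ϑ, d, u, S, T⟩ v R
  pulses v R := {q | CPS.IsPulse ⟨ϑ, d, u, S, T⟩ v R q.1 q.2}
  causal_sends := by
    rintro v R R' t hR e ⟨r, P, hP, h⟩ ht
    rcases h with ⟨h1, h2, h3⟩ | ⟨w, h1, h2, h3⟩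
    · exact ⟨r, P, hP.congr hR (h3.trans ht), .inl ⟨h1, h2, h3⟩⟩
    · exact ⟨r, P, hP.congr hR (h3.1.1.le.trans ht),
        .inr ⟨w, h1, h2, CPS.isLeast_dealerTimes_congr hR ht h3⟩⟩
  causal_pulses := fun _ _ _ _ hR _ hq ht => CPS.IsPulse.congr hR hq ht

/-! The proof is an induction on rounds with invariant `RoundStart`: the honest `r`-th pulses lie in
one real-time window `[m, m + S]`.

Within a round, two facts about the broadcast carry the argument. An honest dealer signs only when
every honest node has pulsed, and nobody else can send its signature before one message delay has
passed. Hence no echo comes early enough to cause a rejection (`RoundStart.echoTimes_eq_empty`), and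
the reception times of honest dealers span at most `ϑ S + u`. A faulty dealer that is accepted by
two honest nodes is seen by them at times at most `η = d - (d - 2 u) / ϑ` apart
(`RoundStart.accepts_consistent`): the first node forwards the signature, and a much later direct
reception would be rejected because of this echo.

Every `⊥` comes from a faulty dealer, so after `b` of them at most `f - b` faulty values remain, and
trimming leaves an interval `[a, b]` inside the range of honest reception times. Each of `a ≤ ·` and
`· ≤ b` holds for `n - f` dealers. As `2 f < n`, two nodes `v`, `w` share such a dealer, so `a v ≤ b
w + η`; also `b v - a w ≤ ϑ S + u`. Averaging shows that the midpoints differ by at most `(ϑ S + u +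
η) / 2`. The remaining wait adds only clock drift, and `Params.Valid.contraction` says that the
total is at most `S`. -/

/-! ### Hardware clocks. -/

/-- Real-time properties of a hardware clock with rates in `[1, ϑ]`. -/
structure IsClock (ϑ : ℝ) (H : ℝ → ℝ) : Prop where
  rate : ∀ t t' : ℝ, 0 ≤ t → t ≤ t' → t' - t ≤ H t' - H t ∧ H t' - H t ≤ ϑ * (t' - t)

namespace IsClock

variable {ϑ : ℝ} {H : ℝ → ℝ}

theorem le_of_le (hH : IsClock ϑ H) {s t : ℝ} (hs : 0 ≤ s) (h : s ≤ t) : H s ≤ H t := by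
  have := (hH.rate s t hs h).1
  linarith

theorem lt_of_lt (hH : IsClock ϑ H) {s t : ℝ} (hs : 0 ≤ s) (h : s < t) : H s < H t := by
  have := (hH.rate s t hs h.le).1
  linarith

theorem le_iff (hH : IsClock ϑ H) {s t : ℝ} (hs : 0 ≤ s) (ht : 0 ≤ t) : H s ≤ H t ↔ s ≤ t :=
  ⟨fun h => not_lt.1 fun h' => absurd (hH.lt_of_lt ht h') (not_lt.2 h), hH.le_of_le hs⟩

theorem lt_iff (hH : IsClock ϑ H) {s t : ℝ} (hs : 0 ≤ s) (ht : 0 ≤ t) : H s < H t ↔ s < t := by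
  rw [← not_le, ← not_le, hH.le_iff ht hs]

theorem injective (hH : IsClock ϑ H) {s t : ℝ} (hs : 0 ≤ s) (ht : 0 ≤ t) (h : H s = H t) :
    s = t :=
  le_antisymm ((hH.le_iff hs ht).1 h.le) ((hH.le_iff ht hs).1 h.ge)

theorem exists_eq (hH : IsClock ϑ H) {s h : ℝ} (hs : 0 ≤ s) (hh : H s ≤ h) :
    ∃ t, s ≤ t ∧ H t = h := by
  have hcont : ContinuousOn H (Set.Icc s (s + (h - H s))) := by
    refine LipschitzOnWith.continuousOn (K := ϑ.toNNReal) (LipschitzOnWith.of_dist_le_mul ?_)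
    have key : ∀ x y : ℝ, 0 ≤ x → x ≤ y → |H y - H x| ≤ ϑ.toNNReal * |y - x| := by
      intro x y hx hxy
      obtain ⟨h1, h2⟩ := hH.rate x y hx hxy
      rw [abs_of_nonneg (by linarith), abs_of_nonneg (by linarith)]
      exact h2.trans (mul_le_mul_of_nonneg_right (Real.le_coe_toNNReal ϑ) (by linarith))
    intro x hx y hy
    rw [Real.dist_eq, Real.dist_eq]
    rcases le_total x y with hxy | hxy
    · rw [abs_sub_comm, abs_sub_comm x]
      exact key x y (hs.trans hx.1) hxy
    · exact key y x (hs.trans hy.1) hxy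
  have hrate := (hH.rate s (s + (h - H s)) hs (by linarith)).1
  obtain ⟨t, ht, hth⟩ := intermediate_value_Icc (by linarith) hcont ⟨hh, by linarith⟩
  exact ⟨t, ht.1, hth⟩

/-- The real time at which a clock shows a given offset from the midpoint of two readings. -/
theorem bounds_of_eq_midpoint (hH : IsClock ϑ H) {a b t x : ℝ} (hϑ : 1 ≤ ϑ) (ha : 0 ≤ a)
    (hab : a ≤ b) (ht : 0 ≤ t) (hx : ϑ * (b - a) / 2 ≤ x) (h : H t = (H a + H b) / 2 + x) :
    (a + b) / 2 + x / ϑ ≤ t ∧ t ≤ (a + b) / 2 + x := by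
  obtain ⟨h1, h2⟩ := hH.rate a b ha hab
  -- From `b` on, the clock still advances by `x - (H b - H a) / 2`. The rate bounds on `[a, b]`
  -- have the right sign in both directions, so averaging readings instead of real times adds no
  -- error to the drift during `x`.
  have hbt : b ≤ t := (hH.le_iff (ha.trans hab) ht).1 (by linarith)
  obtain ⟨h3, h4⟩ := hH.rate b t (ha.trans hab) hbt
  refine ⟨?_, by linarith⟩
  have : x / ϑ ≤ t - (a + b) / 2 := by
    rw [div_le_iff₀ (by linarith)]
    linarith
  linarith

end IsClock

/-! ### Order statistics and the trimmed midpoint. -/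

theorem List.lt_countP_le_getElem {l : List ℝ} (hl : l.Pairwise (· ≤ ·)) {k : ℕ}
    (hk : k < l.length) : k + 1 ≤ l.countP (fun y => y ≤ l[k]) := by
  have h1 : (l.take (k + 1)).countP (fun y => y ≤ l[k]) = k + 1 := by
    rw [List.countP_eq_length.2, List.length_take]
    · omega
    · intro y hy
      obtain ⟨i, hi, rfl⟩ := List.mem_iff_getElem.1 hy
      rw [List.length_take] at hi
      rw [List.getElem_take, decide_eq_true_eq]
      rcases (show i ≤ k by omega).eq_or_lt with rfl | hik
      · exact le_rfl
      · exact List.pairwise_iff_getElem.1 hl i k (by omega) hk hik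
  rw [← h1]
  exact (List.take_sublist _ _).countP_le

theorem List.le_countP_getElem_le {l : List ℝ} (hl : l.Pairwise (· ≤ ·)) {k : ℕ}
    (hk : k < l.length) : l.length ≤ l.countP (fun y => l[k] ≤ y) + k := by
  have h1 : (l.drop k).countP (fun y => l[k] ≤ y) = l.length - k := by
    rw [List.countP_eq_length.2, List.length_drop]
    intro y hy
    obtain ⟨i, hi, rfl⟩ := List.mem_iff_getElem.1 hy
    rw [List.length_drop] at hi
    rw [List.getElem_drop, decide_eq_true_eq]
    rcases (show k ≤ k + i by omega).eq_or_lt with hik | hik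
    · simp only [← hik, le_refl]
    · exact List.pairwise_iff_getElem.1 hl k (k + i) hk (by omega) hik
  have h2 := (List.drop_sublist k l).countP_le (p := fun y => l[k] ≤ y)
  omega

theorem Multiset.countP_filterMap_eq {α β : Type*} (x : α → Option β) (p : β → Prop)
    [DecidablePred p] [DecidablePred fun a => ∃ y, x a = some y ∧ p y] (s : Multiset α) :
    (s.filterMap x).countP p = s.countP fun a => ∃ y, x a = some y ∧ p y := by
  induction s using Multiset.induction with
  | empty => simp
  | cons a s ih =>
    cases h : x a with
    | none => simp [Multiset.filterMap_cons_none _ _ h, ih, h]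
    | some y => simp [Multiset.filterMap_cons_some _ _ _ h, ih, h, Multiset.countP_cons]

namespace CPS

variable {n : ℕ}

theorem pairwise_sortedValues (x : Fin n → Option ℝ) : (sortedValues x).Pairwise (· ≤ ·) :=
  Multiset.pairwise_sort _ _

/-- The sorted list has forgotten which node gave which value. Counting with multiplicity recovers
sets of nodes, on which the quorum arguments operate. -/
theorem exists_finset_card_eq_countP (x : Fin n → Option ℝ) (p : ℝ → Prop) [DecidablePred p] :
    ∃ A : Finset (Fin n), A.card = (sortedValues x).countP (fun y => p y) ∧
      ∀ w ∈ A, ∃ y, x w = some y ∧ p y := by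
  classical
  refine ⟨Finset.univ.filter fun a => ∃ y, x a = some y ∧ p y, ?_, fun w hw => ?_⟩
  · rw [← Multiset.coe_countP, sortedValues, Multiset.sort_eq, Finset.card_def, Finset.filter_val,
      ← Multiset.countP_eq_card_filter]
    exact (Multiset.countP_filterMap_eq x p _).symm
  · simpa using hw

theorem length_sortedValues_add_numBot (x : Fin n → Option ℝ) :
    (sortedValues x).length + numBot x = n := by
  classical
  have h1 := Multiset.countP_filterMap_eq x (fun _ => True) (Finset.univ : Finset (Fin n)).val
  rw [Multiset.countP_eq_card.2 fun _ _ => trivial] at h1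
  rw [sortedValues, Multiset.length_sort, h1, numBot, Finset.card_def, Finset.filter_val,
    ← Multiset.countP_eq_card_filter]
  have h2 := Multiset.card_eq_countP_add_countP (fun w => (x w).isNone = true)
    (Finset.univ : Finset (Fin n)).val
  rw [Finset.card_val, Finset.card_univ, Fintype.card_fin] at h2
  rw [add_comm]
  convert h2.symm using 2
  refine Multiset.countP_congr rfl fun w _ => ?_
  cases x w <;> simp

/-- After trimming, the retained interval is bounded by order statistics. -/
theorem IsTrimmedMidpoint.exists_bounds {f : ℕ} {x : Fin n → Option ℝ} {m : ℝ}
    (h : IsTrimmedMidpoint f x m) (hb : numBot x ≤ f) :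
    ∃ lo hi : ℝ, m = (lo + hi) / 2 ∧ lo ≤ hi ∧
      (∃ A : Finset (Fin n), f + 1 ≤ A.card + numBot x ∧ ∀ w ∈ A, ∃ y, x w = some y ∧ y ≤ lo) ∧
      (∃ A : Finset (Fin n), n ≤ A.card + f ∧ ∀ w ∈ A, ∃ y, x w = some y ∧ lo ≤ y) ∧
      (∃ A : Finset (Fin n), f + 1 ≤ A.card + numBot x ∧ ∀ w ∈ A, ∃ y, x w = some y ∧ hi ≤ y) ∧
      (∃ A : Finset (Fin n), n ≤ A.card + f ∧ ∀ w ∈ A, ∃ y, x w = some y ∧ y ≤ hi) := by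
  obtain ⟨hlen, lo, hi, hlo, hhi, hm⟩ := h
  have hsort := pairwise_sortedValues x
  have hn := length_sortedValues_add_numBot x
  obtain ⟨hk, rfl⟩ := List.getElem?_eq_some_iff.1 hlo
  obtain ⟨hk', rfl⟩ := List.getElem?_eq_some_iff.1 hhi
  refine ⟨_, _, hm, ?_, ?_, ?_, ?_, ?_⟩
  · rcases (show f - numBot x ≤ (sortedValues x).length - 1 - (f - numBot x) by omega).eq_or_lt
      with hik | hik
    · simp only [← hik, le_refl]
    · exact List.pairwise_iff_getElem.1 hsort _ _ hk hk' hik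
  · obtain ⟨A, hA, hA'⟩ := exists_finset_card_eq_countP x
      (fun y => y ≤ (sortedValues x)[f - numBot x])
    have := List.lt_countP_le_getElem hsort hk
    exact ⟨A, by omega, hA'⟩
  -- With `b` values `⊥` there are `n - b` entries, and `f - b` precede `lo`, so `n - f` entries are
  -- at least `lo`, whatever `b ≤ f` is.
  · obtain ⟨A, hA, hA'⟩ := exists_finset_card_eq_countP x
      (fun y => (sortedValues x)[f - numBot x] ≤ y)
    have := List.le_countP_getElem_le hsort hk
    exact ⟨A, by omega, hA'⟩
  · obtain ⟨A, hA, hA'⟩ := exists_finset_card_eq_countP x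
      (fun y => (sortedValues x)[(sortedValues x).length - 1 - (f - numBot x)] ≤ y)
    have := List.le_countP_getElem_le hsort hk'
    exact ⟨A, by omega, hA'⟩
  · obtain ⟨A, hA, hA'⟩ := exists_finset_card_eq_countP x
      (fun y => y ≤ (sortedValues x)[(sortedValues x).length - 1 - (f - numBot x)])
    have := List.lt_countP_le_getElem hsort hk'
    exact ⟨A, by omega, hA'⟩

theorem exists_isTrimmedMidpoint {f : ℕ} {x : Fin n → Option ℝ} (hb : numBot x ≤ f)
    (hf : 2 * f < n) : ∃ m, IsTrimmedMidpoint f x m := by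
  have hn := length_sortedValues_add_numBot x
  exact ⟨_, by omega, _, _, List.getElem?_eq_getElem (by omega),
    List.getElem?_eq_getElem (by omega), rfl⟩

theorem IsTrimmedMidpoint.unique {f : ℕ} {x : Fin n → Option ℝ} {m m' : ℝ}
    (h : IsTrimmedMidpoint f x m) (h' : IsTrimmedMidpoint f x m') : m = m' := by
  obtain ⟨-, lo, hi, h1, h2, rfl⟩ := h
  obtain ⟨-, lo', hi', h1', h2', rfl⟩ := h'
  rw [Option.some.inj (h1.symm.trans h1'), Option.some.inj (h2.symm.trans h2')]

/-! ### Determinism of the algorithm. -/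

theorem TCB.unique {c : Params} {v : Fin n} {R : Set (Reception n)} {r : ℕ} {P : ℝ} {w : Fin n}
    {o o' : Option ℝ} {τ τ' : ℝ} (h : TCB c v R r P w o τ) (h' : TCB c v R r P w o' τ') :
    o = o' ∧ τ = τ' := by
  have key {s : Set ℝ} {a : ℝ} (ha : IsLeast s a) (hs : s = ∅) : False := by
    simpa [hs] using ha.1
  cases h with
  | own a hw ha =>
    cases h' with
    | own b _ hb => simp [ha.unique hb]
    | _ => contradiction
  | missing hw ha =>
    cases h' with
    | own => contradiction
    | missing => simp
    | rejected b b' _ hb hb' => exact (key hb ha).elim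
    | accepted b _ hb hb' => exact (key hb ha).elim
  | rejected a a' hw ha ha' =>
    cases h' with
    | own => contradiction
    | missing _ hb => exact (key ha hb).elim
    | rejected b b' _ hb hb' =>
      obtain rfl := ha.unique hb
      simp [ha'.unique hb']
    | accepted b _ hb hb' =>
      obtain rfl := ha.unique hb
      exact (key ha' hb').elim
  | accepted a hw ha ha' =>
    cases h' with
    | own => contradiction
    | missing _ hb => exact (key ha hb).elim
    | rejected b b' _ hb hb' =>
      obtain rfl := ha.unique hb
      exact (key hb' ha').elim
    | accepted b _ hb hb' =>
      obtain rfl := ha.unique hb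
      simp

theorem IsPulse.pos {c : Params} {v : Fin n} {R : Set (Reception n)} {r : ℕ} {P : ℝ}
    (h : IsPulse c v R r P) : 1 ≤ r := by
  cases h <;> omega

/-- This reduces every claim about pulses of an execution to the pulse times built in the induction.
-/
theorem IsPulse.unique {c : Params} {v : Fin n} {R : Set (Reception n)} {r : ℕ} {P P' : ℝ}
    (h : IsPulse c v R r P) (h' : IsPulse c v R r P') : P = P' := by
  induction h generalizing P' with
  | first =>
    cases h' with
    | first => rfl
    | next r P Δ h τ hP => exact absurd hP.pos (by omega)
  | next r P Δ h τ hP htcb hΔ hτ ih =>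
    generalize hs : r + 1 = s at h'
    cases h' with
    | first => exact absurd hP.pos (by omega)
    | next r' P' Δ' h' τ' hP' htcb' hΔ' hτ' =>
      obtain rfl : r = r' := by omega
      obtain rfl := ih hP'
      obtain rfl : h = h' := funext fun w => ((htcb w).unique (htcb' w)).1
      rw [hΔ.unique hΔ']

end CPS

/-! ### Parameter conditions and signatures of honest dealers. -/

namespace CPS

/-- The next pulse is generated when this local time has passed since the midpoint of the local
reception times that delimit the trimmed interval. -/
def Params.wait (c : Params) : ℝ :=
  c.T - c.d + c.u - c.S

/-- The conditions on the parameters under which Algorithm CPS keeps the skew at most `S`. -/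
structure Params.Valid (c : Params) : Prop where
  one_lt : 1 < c.ϑ
  d_pos : 0 < c.d
  u_nonneg : 0 ≤ c.u
  two_u_lt : 2 * c.u < c.d
  S_pos : 0 < c.S
  S_le : c.S ≤ c.d - c.u
  T_eq : c.T = c.ϑ * (c.d + (c.ϑ + 1) * c.S) + c.d - 2 * c.u + c.S
  contraction : (c.ϑ * c.S + c.u + (c.d - (c.d - 2 * c.u) / c.ϑ)) / 2 +
    (c.wait - c.wait / c.ϑ) ≤ c.S

variable {n : ℕ} {E : Execution n} {c : Params}

/-- `E` is an execution of Algorithm CPS with parameters `c`. -/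
abbrev Runs (E : Execution n) (c : Params) : Prop :=
  E.Admissible (CPS n c.ϑ c.d c.u c.S c.T) c.ϑ c.d c.u c.S

theorem Runs.isClock (hE : Runs E c) {v : Fin n} (hv : v ∈ E.honest) :
    IsClock c.ϑ (E.clock v) :=
  ⟨hE.clock_rate v hv⟩

theorem Runs.recvAt_nonneg (hE : Runs E c) {m : Message n} (hm : m ∈ E.msgs) : 0 ≤ m.recvAt :=
  (hE.sent_nonneg m hm).trans (hE.sent_le_recv m hm)

theorem Runs.mem_sends (hE : Runs E c) {m : Message n} (hm : m ∈ E.msgs)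
    (hs : m.sender ∈ E.honest) :
    (⟨m.receiver, m.payload, E.clock m.sender m.sentAt⟩ : Sending n) ∈
      sends c m.sender (E.log m.sender) :=
  (hE.honest_sends _ hs _ _ _ (hE.sent_nonneg m hm)).1 ⟨m, hm, rfl, rfl, rfl, rfl⟩

/-- Clocks run at rate at least 1, so a bound on local reception times bounds the real sending
times, and only finitely many messages are sent by then. -/
theorem Runs.exists_isLeast (hE : Runs E c) {v : Fin n} (hv : v ∈ E.honest) {s : Set ℝ} {B : ℝ}
    (hs : ∀ h ∈ s, h ≤ B ∧ ∃ e ∈ E.log v, e.localTime = h) (hne : s.Nonempty) :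
    ∃ h, IsLeast s h := by
  have hfin : s.Finite := by
    refine ((hE.finite_sent (B - E.clock v 0)).image fun m => E.clock v m.recvAt).subset ?_
    intro h hh
    obtain ⟨hB, e, ⟨m, hm, hmv, rfl⟩, rfl⟩ := hs h hh
    refine ⟨m, ⟨hm, ?_⟩, rfl⟩
    have h1 := (hE.clock_rate v hv 0 m.recvAt le_rfl (hE.recvAt_nonneg hm)).1
    have h2 := hE.sent_le_recv m hm
    dsimp only at hB
    linarith
  obtain ⟨h, hh, hmin⟩ := Set.exists_min_image s id hfin hne
  exact ⟨h, hh, fun x hx => hmin x hx⟩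

/-- All honest nodes generate their `r`-th pulse, node `v` at real time `p v ∈ [m, m + S]`. -/
structure RoundStart (E : Execution n) (c : Params) (r : ℕ) (p : Fin n → ℝ) (m : ℝ) : Prop where
  nonneg : ∀ v ∈ E.honest, 0 ≤ p v
  pulse : ∀ v ∈ E.honest, IsPulse c v (E.log v) r (E.clock v (p v))
  lower : ∀ v ∈ E.honest, m ≤ p v
  upper : ∀ v ∈ E.honest, p v ≤ m + c.S

/-- Node `w` sends its signature on `r` itself to all nodes at real time `t`, and only then. -/
structure SignedAt (E : Execution n) (w : Fin n) (r : ℕ) (t : ℝ) : Prop where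
  sentAt_eq : ∀ m ∈ E.msgs, m.sender = w → (⟨w, r⟩ : Signature n) ∈ m.payload → m.sentAt = t
  exists_msg : ∀ v, ∃ m ∈ E.msgs, m.sender = w ∧ m.receiver = v ∧
    m.payload = {(⟨w, r⟩ : Signature n)} ∧ m.sentAt = t

/-- Local duration `ϑ S` lasts between `S` and `ϑ S` in real time. The sending time is unique
because a node relays only signatures of others. -/
theorem RoundStart.exists_signedAt {r : ℕ} {p : Fin n → ℝ} {m : ℝ} (hp : RoundStart E c r p m)
    (hE : Runs E c) (hc : c.Valid) {w : Fin n} (hw : w ∈ E.honest) :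
    ∃ t, p w + c.S ≤ t ∧ t ≤ p w + c.ϑ * c.S ∧ SignedAt E w r t := by
  have hϑ := hc.one_lt
  have hS := hc.S_pos
  have hϑS : 0 < c.ϑ * c.S := by positivity
  have hp0 := hp.nonneg w hw
  obtain ⟨t, ht, hHt⟩ := (hE.isClock hw).exists_eq (h := E.clock w (p w) + c.ϑ * c.S) hp0
    (by linarith)
  obtain ⟨h1, h2⟩ := hE.clock_rate w hw _ _ hp0 ht
  refine ⟨t, ?_, by linarith, ?_, ?_⟩
  · have : c.ϑ * c.S ≤ c.ϑ * (t - p w) := by linarith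
    have := le_of_mul_le_mul_left this (by linarith)
    linarith
  · intro m hm hmw hr
    subst hmw
    obtain ⟨r', P, hP, ⟨h3, h4, -⟩ | ⟨w', hw', h3, -⟩⟩ := hE.mem_sends hm hw
    · simp only at h3 h4
      rw [h3, Finset.mem_singleton, Signature.mk.injEq] at hr
      obtain rfl := hr.2
      obtain rfl := hP.unique (hp.pulse _ hw)
      exact (hE.isClock hw).injective (hE.sent_nonneg m hm) (hp0.trans ht) (h4.trans hHt.symm)
    · simp only at h3
      rw [h3, Finset.mem_singleton, Signature.mk.injEq] at hr
      exact absurd hr.1.symm hw'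
  · intro v
    refine (hE.honest_sends w hw v _ t (hp0.trans ht)).2 ⟨r, _, hp.pulse w hw, .inl ⟨rfl, hHt, ?_⟩⟩
    simp only
    linarith

/-- The signature must first travel from `w`, which takes `d - u`. No induction on relay chains is
needed: honest nodes relay only what came from the dealer itself, and a faulty sender owes the
signature to an honest node, which is either `w` or such a relay. -/
theorem SignedAt.le_sentAt {w : Fin n} {r : ℕ} {t : ℝ} (ht : SignedAt E w r t) (hE : Runs E c)
    (hc : c.Valid) (hw : w ∈ E.honest) {m : Message n} (hm : m ∈ E.msgs)
    (hr : (⟨w, r⟩ : Signature n) ∈ m.payload) (hmw : m.sender ≠ w) :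
    t + (c.d - c.u) ≤ m.sentAt := by
  have hdu : 0 < c.d - c.u := by linarith [hc.two_u_lt, hc.u_nonneg]
  have relay : ∀ m ∈ E.msgs, m.sender ∈ E.honest → (⟨w, r⟩ : Signature n) ∈ m.payload →
      m.sender ≠ w → t + (c.d - c.u) ≤ m.sentAt := by
    intro m hm hs hr hmw
    obtain ⟨r', P, hP, ⟨h1, -, -⟩ | ⟨w', hw', h1, ⟨-, -, e, ⟨m', hm', hm'v, rfl⟩, h2, h3, h4⟩, -⟩⟩ :=
      hE.mem_sends hm hs
    · simp only at h1
      rw [h1, Finset.mem_singleton, Signature.mk.injEq] at hr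
      exact absurd hr.1.symm hmw
    · simp only at h1 h2 h3 h4
      rw [h1, Finset.mem_singleton, Signature.mk.injEq] at hr
      obtain ⟨rfl, rfl⟩ := hr
      have h5 := (hE.isClock hs).injective (hE.recvAt_nonneg hm') (hE.sent_nonneg m hm) h4
      have h6 := (hE.delay m' hm' (.inr (hm'v ▸ hs))).1
      have h7 := ht.sentAt_eq m' hm' h2 h3
      linarith
  by_cases hs : m.sender ∈ E.honest
  · exact relay m hm hs hr hmw
  · obtain ⟨m', hm', hs', -, hr', hle⟩ := hE.unforgeable m hm hs _ hr hw
    have h1 := (hE.delay m' hm' (.inl hs')).1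
    by_cases hw' : m'.sender = w
    · have := ht.sentAt_eq m' hm' hw' hr'
      linarith
    · have := relay m' hm' hs' hr' hw'
      linarith

/-! ### Acceptance, termination and consistency of the broadcast. -/

/-- Node `v` receives the signature of `w` on `r` from `w` at real time `a`, and accepts it in the
round that starts at local time `P`. -/
structure Accepts (E : Execution n) (c : Params) (v : Fin n) (r : ℕ) (P : ℝ) (w : Fin n)
    (a : ℝ) : Prop where
  nonneg : 0 ≤ a
  isLeast : IsLeast (dealerTimes c (E.log v) r P w) (E.clock v a)
  echo : w ≠ v → echoTimes (E.log v) r P w (E.clock v a + c.d - 2 * c.u) = ∅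

theorem exists_real_of_mem_dealerTimes (hE : Runs E c) {v w : Fin n} {r : ℕ} {P h : ℝ}
    (hh : h ∈ dealerTimes c (E.log v) r P w) :
    ∃ m ∈ E.msgs, m.receiver = v ∧ m.sender = w ∧ (⟨w, r⟩ : Signature n) ∈ m.payload ∧
      0 ≤ m.recvAt ∧ E.clock v m.recvAt = h := by
  obtain ⟨-, -, e, ⟨m, hm, hmv, rfl⟩, h1, h2, h3⟩ := hh
  exact ⟨m, hm, hmv, h1, h2, hE.recvAt_nonneg hm, h3⟩

theorem TCB.exists_accepts (hE : Runs E c) {v w : Fin n} {r : ℕ} {P h τ : ℝ}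
    (htcb : TCB c v (E.log v) r P w (some h) τ) :
    ∃ a, E.clock v a = h ∧ Accepts E c v r P w a := by
  cases htcb with
  | own _ hw hh =>
    obtain ⟨m, -, -, -, -, h1, rfl⟩ := exists_real_of_mem_dealerTimes hE hh.1
    exact ⟨_, rfl, h1, hh, fun hw' => absurd hw hw'⟩
  | accepted _ hw hh he =>
    obtain ⟨m, -, -, -, -, h1, rfl⟩ := exists_real_of_mem_dealerTimes hE hh.1
    exact ⟨_, rfl, h1, hh, fun _ => he⟩

namespace RoundStart

variable {r : ℕ} {p : Fin n → ℝ} {m : ℝ}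

/-- The direct message leaves after all honest pulses and arrives at most `S + ϑ S + d` after the
receiver's pulse; a factor `ϑ` converts this to local time and gives the acceptance window. -/
theorem dealerTimes_nonempty (hp : RoundStart E c r p m) (hE : Runs E c) (hc : c.Valid)
    {v w : Fin n} (hv : v ∈ E.honest) (hw : w ∈ E.honest) :
    (dealerTimes c (E.log v) r (E.clock v (p v)) w).Nonempty := by
  obtain ⟨t, h1, h2, ht⟩ := hp.exists_signedAt hE hc hw
  obtain ⟨m', hm', rfl, rfl, h3, rfl⟩ := ht.exists_msg v
  obtain ⟨h4, h5⟩ := hE.delay m' hm' (.inl hw)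
  have hdu : 0 < c.d - c.u := by linarith [hc.two_u_lt, hc.u_nonneg]
  have h6 := hp.lower _ hw
  have h7 := hp.upper _ hv
  have h8 := hp.lower _ hv
  have h9 := hp.upper _ hw
  obtain ⟨h10, h11⟩ := hE.clock_rate _ hv (p m'.receiver) m'.recvAt (hp.nonneg _ hv) (by linarith)
  refine ⟨E.clock m'.receiver m'.recvAt, by linarith, ?_, _, ⟨m', hm', rfl, rfl⟩, rfl, ?_, rfl⟩
  · have : c.ϑ * (m'.recvAt - p m'.receiver) ≤ c.ϑ * (c.d + (c.ϑ + 1) * c.S) := by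
      refine mul_le_mul_of_nonneg_left ?_ (by linarith [hc.one_lt])
      linarith
    linarith
  · simp [h3]

theorem recvAt_mem_of_accepts (hE : Runs E c) {v w : Fin n} {P a t : ℝ}
    (ht : SignedAt E w r t) (hv : v ∈ E.honest) (ha0 : 0 ≤ a)
    (ha : E.clock v a ∈ dealerTimes c (E.log v) r P w) : t + c.d - c.u ≤ a ∧ a ≤ t + c.d := by
  obtain ⟨m', hm', h1, h2, h3, h4, h5⟩ := exists_real_of_mem_dealerTimes hE ha
  obtain rfl := (hE.isClock hv).injective h4 ha0 h5
  obtain ⟨h6, h7⟩ := hE.delay m' hm' (.inr (h1 ▸ hv))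
  have := ht.sentAt_eq m' hm' h2 h3
  constructor <;> linarith

/-- If `w` signs at `t`, the direct message arrives by `t + d` and an echo not before `t + 2 (d -
u)`. The gap is at least `d - 2 u`, also on the local clock, and the echo window is open on the
right. -/
theorem echoTimes_eq_empty (hp : RoundStart E c r p m) (hE : Runs E c) (hc : c.Valid)
    {v w : Fin n} (hv : v ∈ E.honest) (hw : w ∈ E.honest) {P h : ℝ}
    (hh : h ∈ dealerTimes c (E.log v) r P w) :
    echoTimes (E.log v) r P w (h + c.d - 2 * c.u) = ∅ := by
  obtain ⟨t, -, -, ht⟩ := hp.exists_signedAt hE hc hw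
  obtain ⟨m₁, hm₁, -, -, -, h0, rfl⟩ := exists_real_of_mem_dealerTimes hE hh
  obtain ⟨-, h1⟩ := recvAt_mem_of_accepts hE ht hv h0 hh
  refine Set.eq_empty_of_forall_notMem ?_
  rintro x ⟨-, hx, e, ⟨m', hm', hmv, rfl⟩, h2, h3, h4⟩
  simp only at h2 h3 h4
  have h5 := ht.le_sentAt hE hc hw hm' h3 h2
  have h6 := (hE.delay m' hm' (.inr (hmv ▸ hv))).1
  have h7 : m₁.recvAt + (c.d - 2 * c.u) ≤ m'.recvAt := by linarith
  have h8 := (hE.clock_rate v hv m₁.recvAt m'.recvAt h0 (by linarith [hc.two_u_lt])).1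
  linarith

theorem ne_none_of_TCB (hp : RoundStart E c r p m) (hE : Runs E c) (hc : c.Valid) {v w : Fin n}
    (hv : v ∈ E.honest) (hw : w ∈ E.honest) {o : Option ℝ} {τ : ℝ}
    (htcb : TCB c v (E.log v) r (E.clock v (p v)) w o τ) : o ≠ none := by
  rintro rfl
  cases htcb with
  | missing _ hh => exact (hp.dealerTimes_nonempty hE hc hv hw).ne_empty hh
  | rejected h h' _ hh he =>
    have := he.1
    rw [hp.echoTimes_eq_empty hE hc hv hw hh.1] at this
    exact this

theorem exists_TCB (hp : RoundStart E c r p m) (hE : Runs E c) (hc : c.Valid) {v : Fin n}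
    (hv : v ∈ E.honest) (w : Fin n) :
    ∃ o τ, TCB c v (E.log v) r (E.clock v (p v)) w o τ ∧
      τ ≤ E.clock v (p v) + c.ϑ * (c.d + (c.ϑ + 1) * c.S) + (c.d - 2 * c.u) := by
  have hdu := hc.two_u_lt
  rcases (dealerTimes c (E.log v) r (E.clock v (p v)) w).eq_empty_or_nonempty with hh | hh
  -- `missing` does not apply to the own instance, where an honest node always receives its message.
  · refine ⟨_, _, .missing ?_ hh, by linarith⟩
    rintro rfl
    exact (hp.dealerTimes_nonempty hE hc hv hv).ne_empty hh
  · obtain ⟨h, hh⟩ := hE.exists_isLeast hv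
      (fun h hh => ⟨hh.2.1, by obtain ⟨e, he, -, -, h4⟩ := hh.2.2; exact ⟨e, he, h4⟩⟩) hh
    have hle := hh.1.2.1
    by_cases hw : w = v
    · exact ⟨_, _, .own h hw hh, by linarith⟩
    rcases (echoTimes (E.log v) r (E.clock v (p v)) w
      (h + c.d - 2 * c.u)).eq_empty_or_nonempty with he | he
    · exact ⟨_, _, .accepted h hw hh he, max_le (by linarith) (by linarith)⟩
    · obtain ⟨h', he⟩ := hE.exists_isLeast hv
        (fun h hh => ⟨hh.2.1.le, by obtain ⟨e, he, -, -, h4⟩ := hh.2.2; exact ⟨e, he, h4⟩⟩) he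
      have := he.1.2.1
      exact ⟨_, _, .rejected h h' hw hh he, max_le (by linarith) (by linarith)⟩

/-- If two honest nodes accept the same dealer, then their reception times are close. -/
theorem accepts_consistent (hp : RoundStart E c r p m) (hE : Runs E c) (hc : c.Valid)
    {v v' w : Fin n} (hv : v ∈ E.honest) (hv' : v' ∈ E.honest) {a a' : ℝ}
    (ha : Accepts E c v r (E.clock v (p v)) w a)
    (ha' : Accepts E c v' r (E.clock v' (p v')) w a') :
    a' ≤ a + (c.d - (c.d - 2 * c.u) / c.ϑ) := by
  have hϑ := hc.one_lt
  have hd := hc.d_pos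
  have hu := hc.u_nonneg
  have h2u := hc.two_u_lt
  have hη : c.u ≤ c.d - (c.d - 2 * c.u) / c.ϑ := by
    have : (c.d - 2 * c.u) / c.ϑ ≤ c.d - 2 * c.u := div_le_self (by linarith) hϑ.le
    linarith
  by_cases hw : w ∈ E.honest
  · obtain ⟨t, -, -, ht⟩ := hp.exists_signedAt hE hc hw
    have h1 := recvAt_mem_of_accepts hE ht hv ha.nonneg ha.isLeast.1
    have h2 := recvAt_mem_of_accepts hE ht hv' ha'.nonneg ha'.isLeast.1
    linarith [h1.1, h2.2]
  have hwv : w ≠ v := fun h => hw (h ▸ hv)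
  have hwv' : w ≠ v' := fun h => hw (h ▸ hv')
  -- The faulty dealer differs from `v`, so `v` forwards at time `a`; this echo reaches `v'` by `a +
  -- d`.
  obtain ⟨m', hm', rfl, rfl, h1, h2⟩ := (hE.honest_sends v hv v' {⟨w, r⟩} a ha.nonneg).2
    ⟨r, _, hp.pulse v hv, .inr ⟨w, hwv, rfl, ha.isLeast⟩⟩
  obtain ⟨h3, h4⟩ := hE.delay m' hm' (.inl hv)
  have h5 := ((hE.isClock hv).lt_iff (hp.nonneg _ hv) ha.nonneg).1 ha.isLeast.1.1
  -- The echo counts only after the pulse of `v'`; this is where `S ≤ d - u` is needed.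
  have h6 : p m'.receiver < m'.recvAt := by
    linarith [hp.lower _ hv, hp.upper _ hv', hc.S_le]
  have h7 := (hE.isClock hv').lt_of_lt (hp.nonneg _ hv') h6
  -- An earlier echo would have made `v'` reject. So `v'` accepted at least `(d - 2 u) / ϑ` before
  -- the echo came.
  have h8 : E.clock m'.receiver a' + c.d - 2 * c.u ≤ E.clock m'.receiver m'.recvAt := by
    by_contra h8
    refine Set.eq_empty_iff_forall_notMem.1 (ha'.echo hwv') _
      ⟨h7, not_le.1 h8, _, ⟨m', hm', rfl, rfl⟩, hwv.symm, ?_, rfl⟩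
    simp [h1]
  have h9 : a' ≤ m'.recvAt :=
    ((hE.isClock hv').le_iff ha'.nonneg (hE.recvAt_nonneg hm')).1 (by linarith)
  have h10 := (hE.clock_rate _ hv' a' m'.recvAt ha'.nonneg h9).2
  have h11 : (c.d - 2 * c.u) / c.ϑ ≤ m'.recvAt - a' := by
    rw [div_le_iff₀ (by linarith)]
    linarith
  linarith

end RoundStart

end CPS

/-! ### Quorum counting and the step to the next round. -/

theorem two_mul_ceil_half_sub_one_lt {n : ℕ} (hn : 1 ≤ n) : 2 * (⌈(n : ℝ) / 2⌉₊ - 1) < n := by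
  have hn' : (1 : ℝ) ≤ n := by exact_mod_cast hn
  have h1 : 0 < ⌈(n : ℝ) / 2⌉₊ := Nat.ceil_pos.2 (by linarith)
  have h2 : (⌈(n : ℝ) / 2⌉₊ : ℝ) < (n : ℝ) / 2 + 1 := Nat.ceil_lt_add_one (by linarith)
  have h3 : 2 * ⌈(n : ℝ) / 2⌉₊ < n + 2 := by
    have : (2 * ⌈(n : ℝ) / 2⌉₊ : ℝ) < n + 2 := by linarith
    exact_mod_cast this
  omega

namespace CPS

variable {n : ℕ} {E : Execution n} {c : Params}

theorem Params.Valid.wait_eq (hc : c.Valid) :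
    c.wait = c.ϑ * c.d + c.ϑ * (c.ϑ + 1) * c.S - c.u := by
  rw [Params.wait, hc.T_eq]
  ring

/-- The trimmed interval has length at most `ϑ S + u`, so this puts the next pulse after its right
end, as `IsClock.bounds_of_eq_midpoint` requires. -/
theorem Params.Valid.le_wait (hc : c.Valid) : c.ϑ * (c.ϑ * c.S + c.u) / 2 ≤ c.wait := by
  rw [hc.wait_eq]
  nlinarith [hc.one_lt, hc.d_pos, hc.u_nonneg, hc.two_u_lt, hc.S_pos,
    mul_pos (by linarith [hc.one_lt] : 0 < c.ϑ) hc.S_pos,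
    mul_pos (by linarith [hc.one_lt] : 0 < c.ϑ) (mul_pos (by linarith [hc.one_lt] : 0 < c.ϑ) hc.S_pos),
    mul_pos (sub_pos.2 hc.one_lt) (sub_pos.2 hc.two_u_lt), mul_pos (sub_pos.2 hc.one_lt) hc.d_pos]

/-- Nodes with value `⊥` are faulty and lie outside `A`. Together with `A` they number more than
`f`, so `A` cannot be faulty throughout. -/
theorem exists_honest_mem {f : ℕ} (hf : E.honestᶜ.card ≤ f) {x : Fin n → Option ℝ}
    (hx : ∀ w ∈ E.honest, x w ≠ none) {A : Finset (Fin n)} (hA : f + 1 ≤ A.card + numBot x)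
    (hA' : ∀ w ∈ A, x w ≠ none) : ∃ w ∈ A, w ∈ E.honest := by
  by_contra! h
  have hdisj : Disjoint A (Finset.univ.filter fun w => (x w).isNone = true) := by
    rw [Finset.disjoint_left]
    intro w hw hw'
    exact hA' w hw (by simpa using hw')
  have hsub : A ∪ Finset.univ.filter (fun w => (x w).isNone = true) ⊆ E.honestᶜ := by
    intro w hw
    rw [Finset.mem_compl]
    rcases Finset.mem_union.1 hw with hw | hw
    · exact h w hw
    · exact fun hw' => hx w hw' (by simpa using hw)
  have h1 := Finset.card_le_card hsub
  rw [Finset.card_union_of_disjoint hdisj] at h1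
  rw [numBot] at hA
  omega

theorem numBot_le {f : ℕ} (hf : E.honestᶜ.card ≤ f) {x : Fin n → Option ℝ}
    (hx : ∀ w ∈ E.honest, x w ≠ none) : numBot x ≤ f := by
  refine (Finset.card_le_card fun w hw => ?_).trans hf
  rw [Finset.mem_compl]
  exact fun hw' => hx w hw' (by simpa using hw)

/-- Any two sets of `n - f` nodes intersect. -/
theorem exists_mem_inter {f : ℕ} (hf : 2 * f < n) {A B : Finset (Fin n)} (hA : n ≤ A.card + f)
    (hB : n ≤ B.card + f) : ∃ w, w ∈ A ∧ w ∈ B := by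
  by_contra! h
  have h1 := Finset.card_union_of_disjoint (Finset.disjoint_left.2 h)
  have h2 := Finset.card_le_univ (A ∪ B)
  rw [Fintype.card_fin] at h2
  omega

namespace RoundStart

variable {r : ℕ} {p : Fin n → ℝ} {m : ℝ}

/-- The next pulse of an honest node, at real time `t`.  The trimmed interval of reception times is
`[a, b]`, in real time. -/
theorem exists_next_pulse (hp : RoundStart E c r p m) (hE : Runs E c) (hc : c.Valid) (hn : 1 ≤ n)
    (hf : E.honestᶜ.card ≤ ⌈(n : ℝ) / 2⌉₊ - 1) {v : Fin n} (hv : v ∈ E.honest) :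
    ∃ t a b : ℝ, 0 ≤ t ∧ IsPulse c v (E.log v) (r + 1) (E.clock v t) ∧
      m + c.S + c.d - c.u ≤ a ∧ a ≤ b ∧ b ≤ m + c.S + c.ϑ * c.S + c.d ∧
      (a + b) / 2 + c.wait / c.ϑ ≤ t ∧ t ≤ (a + b) / 2 + c.wait ∧
      (∃ A : Finset (Fin n), n ≤ A.card + (⌈(n : ℝ) / 2⌉₊ - 1) ∧
        ∀ w ∈ A, ∃ y, Accepts E c v r (E.clock v (p v)) w y ∧ a ≤ y) ∧
      (∃ A : Finset (Fin n), n ≤ A.card + (⌈(n : ℝ) / 2⌉₊ - 1) ∧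
        ∀ w ∈ A, ∃ y, Accepts E c v r (E.clock v (p v)) w y ∧ y ≤ b) := by
  have hclock := hE.isClock hv
  choose o τ htcb hτ using hp.exists_TCB hE hc hv
  set P := E.clock v (p v) with hP
  set f := ⌈(n : ℝ) / 2⌉₊ - 1
  set x : Fin n → Option ℝ := fun w => (o w).map fun y => y - P - c.d + c.u - c.S with hxdef
  have hx : ∀ w ∈ E.honest, x w ≠ none := fun w hw => by
    simpa [hxdef] using hp.ne_none_of_TCB hE hc hv hw (htcb w)
  have hacc : ∀ {w y}, x w = some y →
      ∃ a, Accepts E c v r P w a ∧ E.clock v a = y + P + c.d - c.u + c.S := by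
    intro w y hy
    obtain ⟨h, hh, rfl⟩ := Option.map_eq_some_iff.1 hy
    obtain ⟨a, rfl, ha⟩ := TCB.exists_accepts hE (hh ▸ htcb w)
    exact ⟨a, ha, by ring⟩
  have hb := numBot_le hf hx
  obtain ⟨Δ, hΔ⟩ := exists_isTrimmedMidpoint hb (two_mul_ceil_half_sub_one_lt hn)
  obtain ⟨lo, hi, hmid, hlohi, ⟨A₁, hA₁, hlo⟩, ⟨A₂, hA₂, hlo'⟩, ⟨A₃, hA₃, hhi⟩, A₄, hA₄, hhi'⟩ :=
    hΔ.exists_bounds hb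
  have honest_times : ∀ {w a}, w ∈ E.honest → Accepts E c v r P w a →
      m + c.S + c.d - c.u ≤ a ∧ a ≤ m + c.S + c.ϑ * c.S + c.d := by
    intro w a hw ha
    obtain ⟨t, h1, h2, ht⟩ := hp.exists_signedAt hE hc hw
    obtain ⟨h3, h4⟩ := recvAt_mem_of_accepts hE ht hv ha.nonneg ha.isLeast.1
    have := hp.lower w hw
    have := hp.upper w hw
    constructor <;> linarith
  -- `lo` may stem from a faulty dealer, but some honest dealer has a value at most `lo`, and its
  -- reception time bounds `a` from below.
  obtain ⟨a, ha0, ha, hHa⟩ : ∃ a, 0 ≤ a ∧ m + c.S + c.d - c.u ≤ a ∧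
      E.clock v a = lo + P + c.d - c.u + c.S := by
    obtain ⟨w, hwA, hw⟩ := exists_honest_mem hf hx hA₁ fun w hw => by
      obtain ⟨y, hy, -⟩ := hlo w hw
      simp [hy]
    obtain ⟨y, hy, hylo⟩ := hlo w hwA
    obtain ⟨a', ha', hHa'⟩ := hacc hy
    obtain ⟨a, haa', ha⟩ := hclock.exists_eq (h := lo + P + c.d - c.u + c.S) ha'.nonneg
      (by linarith)
    exact ⟨a, ha'.nonneg.trans haa', (honest_times hw ha').1.trans haa', ha⟩
  obtain ⟨b, hab, hHb⟩ := hclock.exists_eq (h := hi + P + c.d - c.u + c.S) ha0 (by linarith)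
  have hb0 := ha0.trans hab
  have hbm : b ≤ m + c.S + c.ϑ * c.S + c.d := by
    obtain ⟨w, hwA, hw⟩ := exists_honest_mem hf hx hA₃ fun w hw => by
      obtain ⟨y, hy, -⟩ := hhi w hw
      simp [hy]
    obtain ⟨y, hy, hyhi⟩ := hhi w hwA
    obtain ⟨a', ha', hHa'⟩ := hacc hy
    exact ((hclock.le_iff hb0 ha'.nonneg).1 (by linarith)).trans (honest_times hw ha').2
  have hwait : c.ϑ * (b - a) / 2 ≤ c.wait := by
    refine le_trans ?_ hc.le_wait
    have : c.ϑ * (b - a) ≤ c.ϑ * (c.ϑ * c.S + c.u) :=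
      mul_le_mul_of_nonneg_left (by linarith) (by linarith [hc.one_lt])
    linarith
  have hnext : P + Δ + c.T = (E.clock v a + E.clock v b) / 2 + c.wait := by
    rw [hHa, hHb, hmid, Params.wait]
    ring
  have hrate := (hE.clock_rate v hv a b ha0 hab).2
  obtain ⟨t, hbt, hHt⟩ := hclock.exists_eq (h := P + Δ + c.T) hb0 (by linarith)
  have ht0 := hb0.trans hbt
  obtain ⟨ht1, ht2⟩ := hclock.bounds_of_eq_midpoint hc.one_lt.le ha0 hab ht0 hwait
    (hHt.trans hnext)
  refine ⟨t, a, b, ht0, hHt ▸ .next r P Δ o τ (hp.pulse v hv) htcb hΔ fun w => ?_, ha, hab, hbm,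
    ht1, ht2, ⟨A₂, hA₂, fun w hw => ?_⟩, A₄, hA₄, fun w hw => ?_⟩
  -- Since `a` is at least `d - u` after the pulse of `v`, `Δ ≥ -S`. The summand `S` in `T`
  -- compensates for this, and the rest of `T` is the termination bound of `exists_TCB`.
  · have h1 := hp.upper v hv
    have h2 := (hE.clock_rate v hv (p v) a (hp.nonneg v hv)
      (by linarith [hc.two_u_lt, hc.u_nonneg])).1
    have := hτ w
    have := hc.T_eq
    linarith
  · obtain ⟨y, hy, hloy⟩ := hlo' w hw
    obtain ⟨a', ha', hHa'⟩ := hacc hy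
    exact ⟨a', ha', (hclock.le_iff ha0 ha'.nonneg).1 (by linarith)⟩
  · obtain ⟨y, hy, hyhi⟩ := hhi' w hw
    obtain ⟨a', ha', hHa'⟩ := hacc hy
    exact ⟨a', ha', (hclock.le_iff ha'.nonneg hb0).1 (by linarith)⟩

theorem exists_next (hp : RoundStart E c r p m) (hE : Runs E c) (hc : c.Valid) (hn : 1 ≤ n)
    (hf : E.honestᶜ.card ≤ ⌈(n : ℝ) / 2⌉₊ - 1) :
    ∃ p' m', RoundStart E c (r + 1) p' m' ∧ ∀ v ∈ E.honest, ∀ w ∈ E.honest,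
      c.d - c.u + c.wait / c.ϑ ≤ p' v - p w ∧
      p' v - p w ≤ (1 + c.ϑ) * c.S + c.d + c.wait := by
  have hn2 := two_mul_ceil_half_sub_one_lt hn
  choose! p' a b ht0 hpulse ha hab hb hlo hhi hA hB using
    fun v (hv : v ∈ E.honest) => hp.exists_next_pulse hE hc hn hf hv
  have hskew : ∀ v ∈ E.honest, ∀ w ∈ E.honest, p' v ≤ p' w + c.S := by
    intro v hv w hw
    have overlap : ∀ v ∈ E.honest, ∀ w ∈ E.honest,
        a v ≤ b w + (c.d - (c.d - 2 * c.u) / c.ϑ) := by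
      intro v hv w hw
      obtain ⟨A, hA, hA'⟩ := hA v hv
      obtain ⟨B, hB, hB'⟩ := hB w hw
      obtain ⟨x, hxA, hxB⟩ := exists_mem_inter hn2 hA hB
      obtain ⟨y, hy, hay⟩ := hA' x hxA
      obtain ⟨z, hz, hzb⟩ := hB' x hxB
      linarith [hp.accepts_consistent hE hc hw hv hz hy]
    linarith [overlap v hv w hw, hb v hv, ha w hw, hhi v hv, hlo w hw, hc.contraction]
  -- The new window starts at the earliest honest pulse; an honest node exists because `f < n`.
  obtain ⟨v₀, hv₀, hmin⟩ : ∃ v₀ ∈ E.honest, ∀ v ∈ E.honest, p' v₀ ≤ p' v := by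
    refine Finset.exists_min_image _ _ (Finset.card_pos.1 ?_)
    have := Finset.card_compl_add_card E.honest
    rw [Fintype.card_fin] at this
    omega
  refine ⟨p', p' v₀, ⟨ht0, hpulse, hmin, fun v hv => hskew v hv v₀ hv₀⟩, fun v hv w hw => ?_⟩
  constructor <;>
    linarith [ha v hv, hab v hv, hb v hv, hlo v hv, hhi v hv, hp.lower w hw, hp.upper w hw]

end RoundStart

/-! ### Induction over rounds and the synchronization guarantees. -/

/-- Clocks start in `[0, S]` and run at rate at least 1, so they all show `S` within the real-time
window `[0, S]`. -/
theorem exists_first_round (hE : Runs E c) : ∃ p m, RoundStart E c 1 p m := by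
  have : ∀ v ∈ E.honest, ∃ t, 0 ≤ t ∧ t ≤ c.S ∧ E.clock v t = c.S := by
    intro v hv
    obtain ⟨h1, h2⟩ := hE.clock_init v hv
    obtain ⟨t, ht, hHt⟩ := (hE.isClock hv).exists_eq le_rfl h2
    have := (hE.clock_rate v hv 0 t le_rfl ht).1
    exact ⟨t, ht, by linarith, hHt⟩
  choose! p h0 hS hp using this
  exact ⟨p, 0, h0, fun v hv => (hp v hv).symm ▸ .first, h0, fun v hv => by simpa using hS v hv⟩

theorem exists_round (hE : Runs E c) (hc : c.Valid) (hn : 1 ≤ n)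
    (hf : E.honestᶜ.card ≤ ⌈(n : ℝ) / 2⌉₊ - 1) {r : ℕ} (hr : 1 ≤ r) :
    ∃ p m, RoundStart E c r p m := by
  induction r, hr using Nat.le_induction with
  | base => exact exists_first_round hE
  | succ r _ ih =>
    obtain ⟨p, m, hp⟩ := ih
    obtain ⟨p', m', hp', -⟩ := hp.exists_next hE hc hn hf
    exact ⟨p', m', hp'⟩

theorem RoundStart.eq_of_pulseAt {r : ℕ} {p : Fin n → ℝ} {m : ℝ} (hp : RoundStart E c r p m)
    (hE : Runs E c) {v : Fin n} (hv : v ∈ E.honest) {t : ℝ}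
    (ht : E.PulseAt (CPS n c.ϑ c.d c.u c.S c.T) v r t) : t = p v :=
  (hE.isClock hv).injective ht.1 (hp.nonneg v hv) (IsPulse.unique ht.2 (hp.pulse v hv))

theorem isPulseSync (hc : c.Valid) (hn : 1 ≤ n) :
    (CPS n c.ϑ c.d c.u c.S c.T).IsPulseSync c.ϑ c.d c.u c.S (⌈(n : ℝ) / 2⌉₊ - 1) c.S
      (c.d - c.u + c.wait / c.ϑ) ((1 + c.ϑ) * c.S + c.d + c.wait) where
  pmin_pos := by
    have hϑ := hc.one_lt
    have hS := hc.S_pos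
    have hu := hc.u_nonneg
    have : 0 ≤ c.wait := le_trans (by positivity) hc.le_wait
    have : 0 ≤ c.wait / c.ϑ := by positivity
    linarith [hc.two_u_lt]
  liveness E hE hf v hv i hi := by
    obtain ⟨p, m, hp⟩ := exists_round hE hc hn hf hi
    exact ⟨p v, ⟨hp.nonneg v hv, hp.pulse v hv⟩, fun t ht => hp.eq_of_pulseAt hE hv ht⟩
  skew E hE hf v hv w hw i hi t t' ht ht' := by
    obtain ⟨p, m, hp⟩ := exists_round hE hc hn hf hi
    rw [hp.eq_of_pulseAt hE hv ht, hp.eq_of_pulseAt hE hw ht', abs_le]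
    constructor <;> linarith [hp.lower v hv, hp.upper v hv, hp.lower w hw, hp.upper w hw]
  min_period E hE hf v hv w hw i hi t t' ht ht' := by
    obtain ⟨p, m, hp⟩ := exists_round hE hc hn hf hi
    obtain ⟨p', m', hp', h⟩ := hp.exists_next hE hc hn hf
    rw [hp'.eq_of_pulseAt hE hv ht, hp.eq_of_pulseAt hE hw ht']
    exact (h v hv w hw).1
  max_period E hE hf v hv w hw i hi t t' ht ht' := by
    obtain ⟨p, m, hp⟩ := exists_round hE hc hn hf hi
    obtain ⟨p', m', hp', h⟩ := hp.exists_next hE hc hn hf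
    rw [hp'.eq_of_pulseAt hE hv ht, hp.eq_of_pulseAt hE hw ht']
    exact (h v hv w hw).2

end CPS

/-! ### Choice of the numerical parameters. -/

namespace CPS

/-- Parameters for which Algorithm CPS works whenever `ϑ ≤ 1.11` and `u ≤ d / 30`. -/
noncomputable def params (ϑ d u : ℝ) : Params where
  ϑ := ϑ
  d := d
  u := u
  S := 6.15 * u + 6.85 * ((ϑ - 1) * d)
  T := ϑ * (d + (ϑ + 1) * (6.15 * u + 6.85 * ((ϑ - 1) * d))) + d - 2 * u +
    (6.15 * u + 6.85 * ((ϑ - 1) * d))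

theorem params_valid {ϑ d u : ℝ} (hϑ : 1 < ϑ) (hϑ' : ϑ ≤ 1.11) (hd : 0 < d) (hu : 0 ≤ u)
    (hud : u ≤ d / 30) : (params ϑ d u).Valid := by
  have hx : 0 < (ϑ - 1) * d := mul_pos (by linarith) hd
  have hx' : (ϑ - 1) * d ≤ 0.11 * d := mul_le_mul_of_nonneg_right (by linarith) hd.le
  norm_num at hϑ' hx'
  refine ⟨hϑ, hd, hu, ?_, ?_, ?_, rfl, ?_⟩
  · simp only [params]
    linarith
  · simp only [params]
    positivity
  -- This holds because `7.15 / 30 + 6.85 * 0.11 < 1`.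
  · simp only [params]
    norm_num
    linarith
  · have hwait : (params ϑ d u).wait =
        ϑ * d + ϑ * (ϑ + 1) * (6.15 * u + 6.85 * ((ϑ - 1) * d)) - u := by
      simp only [Params.wait, params]
      ring
    rw [hwait]
    simp only [params]
    obtain ⟨x, rfl⟩ : ∃ x, ϑ = 1 + x := ⟨ϑ - 1, by ring⟩
    have h0 : 0 < x := by linarith
    have h1 : x ≤ 11 / 100 := by linarith
    have h2 : x ^ 2 ≤ (11 / 100) ^ 2 := by gcongr
    have h3 : x ^ 3 ≤ (11 / 100) ^ 3 := by gcongr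
    -- Multiplied by `ϑ = 1 + x`, the contraction condition is linear in `u` and `x d`, and these
    -- are the two coefficients. Both decrease in `x`, so `x = 0.11` is the worst case, where `6.15`
    -- and `6.85` barely suffice.
    have coeff_u : 0 ≤ 6.15 * ((1 + x) - (1 + x) ^ 2 / 2 - x * (1 + x) * (2 + x)) -
        ((1 + x) / 2 + 1 - x) := by
      norm_num at h2 h3 ⊢
      linarith
    have coeff_d : 0 ≤ 6.85 * ((1 + x) - (1 + x) ^ 2 / 2 - x * (1 + x) * (2 + x)) -
        (1 / 2 + (1 + x)) := by
      norm_num at h2 h3 ⊢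
      linarith
    have e1 := mul_nonneg hu coeff_u
    have e2 := mul_nonneg (mul_pos h0 hd).le coeff_d
    have hpos : 0 < 1 + x := by linarith
    refine le_of_mul_le_mul_left ?_ hpos
    field_simp
    linarith

end CPS

theorem mainTheorem3 :
    ∃ c C : ℝ, 0 < c ∧ 0 < C ∧
      ∀ ϑ d u : ℝ, 1 < ϑ → ϑ ≤ 1.11 → 0 < d → 0 ≤ u → u ≤ d / 30 →
        ∃ T S Pmin Pmax : ℝ,
          (c * d ≤ T ∧ T ≤ C * d) ∧
          (c * (u + (ϑ - 1) * d) ≤ S ∧ S ≤ C * (u + (ϑ - 1) * d)) ∧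
          (c * d ≤ Pmin ∧ Pmin ≤ C * d) ∧
          (Pmin + c * S ≤ Pmax ∧ Pmax ≤ Pmin + C * S) ∧
          ∀ n : ℕ, 1 ≤ n →
            (CPS n ϑ d u S T).IsPulseSync ϑ d u S (⌈(n : ℝ) / 2⌉₊ - 1) S Pmin Pmax := by
  refine ⟨1 / 2, 10, by norm_num, by norm_num, fun ϑ d u hϑ hϑ' hd hu hud => ?_⟩
  have hc := CPS.params_valid hϑ hϑ' hd hu hud
  have hx : 0 < (ϑ - 1) * d := mul_pos (by linarith) hd
  have hSval : (CPS.params ϑ d u).S = 6.15 * u + 6.85 * ((ϑ - 1) * d) := rfl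
  have hS := hc.S_pos
  have hSle := hc.S_le
  have hwait := hc.wait_eq
  have hwait0 := hc.le_wait
  -- Needed again for the upper bound on `Pmax - Pmin`: it bounds the drift `W - W / ϑ` by `S`.
  have hcon := hc.contraction
  have hT : (CPS.params ϑ d u).T = (CPS.params ϑ d u).wait + d - u + (CPS.params ϑ d u).S := by
    simp only [CPS.Params.wait, show (CPS.params ϑ d u).d = d from rfl,
      show (CPS.params ϑ d u).u = u from rfl]
    ring
  have hsync := fun n hn => CPS.isPulseSync (n := n) hc hn
  simp only [show (CPS.params ϑ d u).ϑ = ϑ from rfl, show (CPS.params ϑ d u).d = d from rfl,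
    show (CPS.params ϑ d u).u = u from rfl] at hSle hwait hwait0 hcon hsync
  set S := (CPS.params ϑ d u).S
  set T := (CPS.params ϑ d u).T
  set W := (CPS.params ϑ d u).wait
  norm_num at hϑ' hSval
  have hη : (d - 2 * u) / ϑ ≤ d - 2 * u := div_le_self (by linarith) hϑ.le
  have hϑS : S ≤ ϑ * S := le_mul_of_one_le_left hS.le hϑ.le
  have hϑS' : ϑ * S ≤ 2 * S := mul_le_mul_of_nonneg_right (by linarith) hS.le
  have hϑd : ϑ * d ≤ 2 * d := mul_le_mul_of_nonneg_right (by linarith) hd.le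
  have hW0 : 0 ≤ W := le_trans (by positivity) hwait0
  have hW : W ≤ 6 * d := by
    have : ϑ * (ϑ + 1) * S ≤ 3 * S := mul_le_mul_of_nonneg_right (by nlinarith) hS.le
    linarith
  have hWϑ : W / ϑ ≤ W := div_le_self hW0 hϑ.le
  have hWϑ0 : 0 ≤ W / ϑ := by positivity
  refine ⟨T, S, d - u + W / ϑ, (1 + ϑ) * S + d + W, ⟨?_, ?_⟩, ⟨?_, ?_⟩, ⟨?_, ?_⟩, ⟨?_, ?_⟩,
    hsync⟩ <;> linarith
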